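/- Fix a set $A$ of atomic propositions. **Markov chains.** A Markov chain $\mathcal M=(T,t_0,p,V)$ has a finite state set $T$, an initial state $t_0\in T$, a transition function $p$ assigning to each $t\in T$ a probability distribution $p(t)$ on $T$, and a labelling $V:T\to 2^A$. For $\alpha\subseteq A$, $\mathbb P^{\mathcal M}(\Diamond\alpha)$ is the sum of $\prod_{i<n}p(t_i)(t_{i+1})$ over all finite sequences $t_0,t_1,\dots,t_n$ (starting in the initial state, $n\ge 0$) with $V(t_n)=\alpha$ and $V(t_i)\neq\alpha$ for all $i<n$. **Interval Markov chains.** An interval Markov chain (IMC) $\mathcal I=(S,s_0,P,V)$ has a finite state set $S$, $s_0\in S$, $V:S\to 2^A$, and $P$ assigns to each $(s,s')\in S\times S$ an interval subset (possibly empty) of $[0,1]$. A Markov chain $\mathcal M=(T,t_0,p,V^M)$ satisfies $\mathcal I=(S,s_0,P,V^I)$ (at-every-step semantics) iff there is a relation $\mathcal R\subseteq T\times S$ with $(t_0,s_0)\in\mathcal R$ such that whenever $(t,s)\in\mathcal R$, $V^M(t)=V^I(s)$ and there is $\delta:T\to(S\to[0,1])$ such that: $\delta(t')$ is a distribution on $S$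 whenever $p(t)(t')>0$; $\sum_{t'\in T}p(t)(t')\,\delta(t')(s')\in P(s,s')$ for all $s'\in S$; and $(t',s')\in\mathcal R$ whenever $\delta(t')(s')>0$. **Parametric IMCs.** A parametric IMC (pIMC) $\mathcal P=(S,s_0,P,V,Y)$ is given by finite sets $S$ (states) and $Y$ (parameters), $s_0\in S$, $V:S\to 2^A$, and for each $(s,s')\in S\times S$ a formal interval $P(s,s')=[f_1,f_2]$ whose endpoints are rational functions in $Y$ with rational coefficients. A valuation $v:Y\to[0,1]$ gives an IMC $v(\mathcal P)=(S,s_0,P_v,V)$, where $P_v(s,s')=v([f_1,f_2])$ is $[v(f_1),v(f_2)]$ if both values are defined and $0\le v(f_1)\le v(f_2)\le 1$, and $\emptyset$ otherwise. Write $\mathcal M\models^a_{\tt pI}\mathcal P$ if $\mathcal M$ satisfies $v(\mathcal P)$ for some valuation $v:Y\to[0,1]$. Let $\mathrm{Succ}(s)=\{s'\in S: P(s,s')\neq[0,0]\}$ and $\mathrm{Pred}(s)=\{s'\in S: P(s',s)\neq[0,0]\}$, where $[0,0]$ is the formal interval whose two endpoints are the zero rational function. **The CSP.** For a pIMC $\mathcal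 P$ and $\alpha\subseteq A$, the constraint satisfaction problem $\mathbf C_{\exists\bar r}(\mathcal P,\alpha)=(X,D,C)$ has the variables $\pi_y\in[0,1]$ for $y\in Y$; $\theta_s^{s'}\in[0,1]$ for $s\in S$, $s'\in\mathrm{Succ}(s)$; and, for each $s\in S$, Booleans $\rho_s,\lambda_s$, integers $\omega_s,\alpha_s\in\{0,\dots,|S|\}$ and a real $\pi_s\in[0,1]$. Its constraints $C$ are, for each $s\in S$: 1. $\rho_s$, if $s=s_0$; 2. $\rho_s\Leftrightarrow\sum_{s'\in\mathrm{Succ}(s)}\theta_s^{s'}=1$; 3. $\neg\rho_s\Leftrightarrow\sum_{s'\in\mathrm{Pred}(s)\setminus\{s\}}\theta_{s'}^{s}=0$, if $s\ne s_0$; 4. $\neg\rho_s\Leftrightarrow\sum_{s'\in\mathrm{Succ}(s)}\theta_s^{s'}=0$; 5. $\rho_s\Rightarrow\theta_s^{s'}\in P_v(s,s')$ with $v=(\pi_y)_{y\in Y}$, for all $s'\in\mathrm{Succ}(s)$; 6. $\omega_s=1$, if $s=s_0$; 7. $\omega_s\ne1$, if $s\ne s_0$; 8. $\rho_s\Leftrightarrow\omega_s\neq0$;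 9. $\omega_s>1\Rightarrow\bigvee_{s'\in\mathrm{Pred}(s)\setminus\{s\}}\big((\omega_s=\omega_{s'}+1)\wedge(\theta_{s'}^{s}>0)\big)$, if $s\ne s_0$; 10. $\omega_s=0\Leftrightarrow\bigwedge_{s'\in\mathrm{Pred}(s)\setminus\{s\}}\big((\omega_{s'}=0)\vee(\theta_{s'}^{s}=0)\big)$, if $s\neq s_0$; 11. $\alpha_s=1$, if $V(s)=\alpha$; 12. $\alpha_s\neq1$, if $V(s)\ne\alpha$; 13. $\lambda_s\Leftrightarrow(\rho_s\wedge\alpha_s\ne0)$; 14. $\alpha_s>1\Rightarrow\bigvee_{s'\in\mathrm{Succ}(s)\setminus\{s\}}\big((\alpha_s=\alpha_{s'}+1)\wedge(\theta_s^{s'}>0)\big)$, if $V(s)\neq\alpha$; 15. $\alpha_s=0\Leftrightarrow\bigwedge_{s'\in\mathrm{Succ}(s)\setminus\{s\}}\big((\alpha_{s'}=0)\vee(\theta_s^{s'}=0)\big)$, if $V(s)\ne\alpha$; 16. $\neg\lambda_s\Rightarrow\pi_s=0$; 17. $\lambda_s\Rightarrow\pi_s=1$, if $V(s)=\alpha$;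 18. $\lambda_s\Rightarrow\pi_s=\sum_{s'\in\mathrm{Succ}(s)}\pi_{s'}\theta_s^{s'}$, if $V(s)\neq\alpha$. A CSP is satisfiable if some valuation of its variables in their domains satisfies all its constraints. **Theorem.** Let $\mathcal P=(S,s_0,P,V,Y)$ be a pIMC, $\alpha\subseteq A$ a label, $p\in[0,1]$, ${\sim}\in\{\le,<,\ge,>\}$ with negation $\not\sim$, and $(X,D,C)=\mathbf C_{\exists\bar r}(\mathcal P,\alpha)$. Then * the CSP $(X,D,C\cup\{\pi_{s_0}\sim p\})$ is satisfiable if and only if there is a Markov chain $\mathcal M\models^a_{\tt pI}\mathcal P$ with $\mathbb P^{\mathcal M}(\Diamond\alpha)\sim p$; * the CSP $(X,D,C\cup\{\pi_{s_0}\not\sim p\})$ is unsatisfiable if and only if every Markov chain $\mathcal M\models^a_{\tt pI}\mathcal P$ has $\mathbb P^{\mathcal M}(\Diamond\alpha)\sim p$. -/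

import Mathlib

universe u v w

/-! Markov chains and reachability probabilities. -/

/-- A Markov chain with finite state set `T` and labels in the powerset of `A`. -/
structure MarkovChain (A : Type w) (T : Type u) [Fintype T] where
  init : T
  trans : T → T → ℝ
  trans_nonneg : ∀ t t', 0 ≤ trans t t'
  trans_sum : ∀ t, ∑ t', trans t t' = 1
  label : T → Set A

namespace MarkovChain

variable {A : Type w} {T : Type u} [Fintype T]

/-- The probability of a finite sequence of states `ω 0, …, ω n`: the product of the transition
probabilities along it (so a sequence that is not a path has probability zero). -/
def pathProb (M : MarkovChain A T) {n : ℕ} (ω : Fin (n + 1) → T) : ℝ :=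
  ∏ i : Fin n, M.trans (ω i.castSucc) (ω i.succ)

open Classical in
/-- The sequences `ω 0, …, ω n` starting in `t` that visit a state labelled exactly `α` for the
first time at position `n`. -/
noncomputable def firstPaths (M : MarkovChain A T) (t : T) (α : Set A) (n : ℕ) :
    Finset (Fin (n + 1) → T) :=
  Finset.univ.filter fun ω =>
    ω 0 = t ∧ M.label (ω (Fin.last n)) = α ∧ ∀ i : Fin n, M.label (ω i.castSucc) ≠ α

theorem sum_firstPaths_zero (M : MarkovChain A T) (t : T) (α : Set A) :
    ∑ ω ∈ M.firstPaths t α 0, M.pathProb ω = if M.label t = α then 1 else 0 := by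
  classical
  unfold firstPaths
  rw [Finset.sum_filter, ← (Equiv.funUnique (Fin 1) T).symm.sum_comp]
  simp [pathProb, ite_and]

theorem sum_firstPaths_succ (M : MarkovChain A T) (t : T) (α : Set A) (n : ℕ) :
    ∑ ω ∈ M.firstPaths t α (n + 1), M.pathProb ω =
      if M.label t = α then 0
      else ∑ t', M.trans t t' * ∑ ω ∈ M.firstPaths t' α n, M.pathProb ω := by
  classical
  unfold firstPaths
  simp_rw [Finset.sum_filter]
  rw [← (Fin.consEquiv fun _ : Fin (n + 2) => T).sum_comp, Fintype.sum_prod_type]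
  simp_rw [Finset.mul_sum]
  rw [Finset.sum_eq_single t (by
    intro b _ hb
    refine Finset.sum_eq_zero fun ω _ => if_neg ?_
    simp [Fin.consEquiv, hb]) (by simp), Finset.sum_comm]
  split_ifs with h
  · refine Finset.sum_eq_zero fun ω _ => if_neg ?_
    rintro ⟨-, -, h'⟩
    exact h' 0 (by simpa [Fin.consEquiv] using h)
  · refine Finset.sum_congr rfl fun ω _ => ?_
    rw [Finset.sum_eq_single (ω 0) (by
      intro b _ hb
      rw [if_neg (by simp [hb.symm]), mul_zero]) (by simp), mul_ite, mul_zero]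
    refine if_congr ?_ ?_ rfl
    · simp only [Fin.consEquiv, Equiv.coe_fn_mk, Fin.forall_fin_succ (n := n), Fin.castSucc_zero,
        Fin.cons_zero, true_and, ← Fin.succ_last, Fin.cons_succ, ← Fin.succ_castSucc]
      tauto
    · simp [pathProb, Fin.prod_univ_succ, Fin.consEquiv]

theorem sum_firstPaths_nonneg (M : MarkovChain A T) (t : T) (α : Set A) (n : ℕ) :
    0 ≤ ∑ ω ∈ M.firstPaths t α n, M.pathProb ω :=
  Finset.sum_nonneg fun _ _ => Finset.prod_nonneg fun _ _ => M.trans_nonneg _ _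

theorem summable_firstPaths (M : MarkovChain A T) (t : T) (α : Set A) :
    Summable fun n : ℕ => ∑ ω ∈ M.firstPaths t α n, M.pathProb ω := by
  refine summable_of_sum_range_le (c := 1) (M.sum_firstPaths_nonneg t α) fun N => ?_
  induction N generalizing t with
  | zero => simp
  | succ N ih =>
    rw [Finset.sum_range_succ']
    simp_rw [sum_firstPaths_succ, sum_firstPaths_zero]
    split_ifs with h
    · simp
    · rw [add_zero, Finset.sum_comm, ← M.trans_sum t]
      refine Finset.sum_le_sum fun t' _ => ?_
      rw [← Finset.mul_sum]
      exact mul_le_of_le_one_right (M.trans_nonneg _ _) (ih t')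

/-- The probability of reaching label `α` from `t`: the sum of the probabilities of all finite
sequences starting in `t` and reaching `α` for the first time at their end. The series
is a convergent series of nonnegative terms, by `summable_firstPaths`. -/
noncomputable def reachProbFrom (M : MarkovChain A T) (t : T) (α : Set A) : ℝ :=
  ∑' n : ℕ, ∑ ω ∈ M.firstPaths t α n, M.pathProb ω

/-- The probability of reaching label `α` from the initial state. -/
noncomputable def reachProb (M : MarkovChain A T) (α : Set A) : ℝ :=
  M.reachProbFrom M.init α

end MarkovChain

/-! Interval Markov chains and the at-every-step semantics. -/

/-- An interval Markov chain with state set `S`; `prob s s'` is an interval subset of `[0,1]`. -/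
structure IMC (A : Type w) (S : Type u) where
  init : S
  prob : S → S → Set ℝ
  prob_interval : ∀ s s', (prob s s').OrdConnected
  prob_subset : ∀ s s', prob s s' ⊆ Set.Icc 0 1
  label : S → Set A

/-- The at-every-step satisfaction relation between Markov chains and interval Markov chains. -/
def MarkovChain.SatisfiesIMC {A : Type w} {T S : Type u} [Fintype T] [Fintype S]
    (M : MarkovChain A T) (I : IMC A S) : Prop :=
  ∃ R : T → S → Prop, R M.init I.init ∧
    ∀ t s, R t s →
      M.label t = I.label s ∧
      ∃ δ : T → S → ℝ,
        (∀ t' s', δ t' s' ∈ Set.Icc (0 : ℝ) 1) ∧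
        (∀ t', 0 < M.trans t t' → ∑ s', δ t' s' = 1) ∧
        (∀ s', ∑ t', M.trans t t' * δ t' s' ∈ I.prob s s') ∧
        (∀ t' s', 0 < δ t' s' → R t' s')

/-! Rational functions and parametric intervals. -/

/-- The rational functions with rational coefficients in the variables `Y`. -/
abbrev RatFn (Y : Type v) : Type v := FractionRing (MvPolynomial Y ℚ)

/-- `f` is defined at the point `v` and has the value `y` there: `f` can be written as a quotient
`g₁ / g₂` of polynomials with `v(g₂) ≠ 0` and `y = v(g₁) / v(g₂)`. -/
def RatHasValue {Y : Type v} (f : RatFn Y) (v : Y → ℝ) (y : ℝ) : Prop :=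
  ∃ g₁ g₂ : MvPolynomial Y ℚ,
    f = algebraMap (MvPolynomial Y ℚ) (RatFn Y) g₁ /
      algebraMap (MvPolynomial Y ℚ) (RatFn Y) g₂ ∧
    MvPolynomial.aeval v g₂ ≠ 0 ∧
    y = MvPolynomial.aeval v g₁ / MvPolynomial.aeval v g₂

theorem RatHasValue.unique {Y : Type v} {f : RatFn Y} {v : Y → ℝ} {y z : ℝ}
    (hy : RatHasValue f v y) (hz : RatHasValue f v z) : y = z := by
  obtain ⟨g₁, g₂, hf, hg, rfl⟩ := hy
  obtain ⟨k₁, k₂, hf', hk, rfl⟩ := hz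
  have hg0 : g₂ ≠ 0 := by rintro rfl; simp at hg
  have hk0 : k₂ ≠ 0 := by rintro rfl; simp at hk
  have inj := IsFractionRing.injective (MvPolynomial Y ℚ) (RatFn Y)
  have hg1 : algebraMap (MvPolynomial Y ℚ) (RatFn Y) g₂ ≠ 0 := by
    intro h; exact hg0 (inj (by rw [h, map_zero]))
  have hk1 : algebraMap (MvPolynomial Y ℚ) (RatFn Y) k₂ ≠ 0 := by
    intro h; exact hk0 (inj (by rw [h, map_zero]))
  rw [hf, div_eq_div_iff hg1 hk1, ← map_mul, ← map_mul] at hf'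
  have h := congrArg (MvPolynomial.aeval v) (inj hf')
  rw [map_mul, map_mul] at h
  rw [div_eq_div_iff hg hk]
  exact h

/-- The value of the parametric interval `[f₁, f₂]` at `v`: the interval `[v(f₁), v(f₂)]` if
`v(f₁)`, `v(f₂)` are defined and `0 ≤ v(f₁) ≤ v(f₂) ≤ 1`, and the empty set otherwise. -/
def paramInterval {Y : Type v} (f₁ f₂ : RatFn Y) (v : Y → ℝ) : Set ℝ :=
  {x | ∃ a b : ℝ, RatHasValue f₁ v a ∧ RatHasValue f₂ v b ∧ 0 ≤ a ∧ a ≤ b ∧ b ≤ 1 ∧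
    x ∈ Set.Icc a b}

theorem paramInterval_ordConnected {Y : Type v} (f₁ f₂ : RatFn Y) (v : Y → ℝ) :
    (paramInterval f₁ f₂ v).OrdConnected := by
  constructor
  rintro x ⟨a, b, ha, hb, h0, hab, h1, hx⟩ y ⟨a', b', -, hb', -, -, -, hy⟩ z hz
  obtain rfl := hb.unique hb'
  exact ⟨a, b, ha, hb, h0, hab, h1, hx.1.trans hz.1, hz.2.trans hy.2⟩

theorem paramInterval_subset {Y : Type v} (f₁ f₂ : RatFn Y) (v : Y → ℝ) :
    paramInterval f₁ f₂ v ⊆ Set.Icc 0 1 := by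
  rintro x ⟨a, b, -, -, h0, -, h1, hx⟩
  exact ⟨h0.trans hx.1, hx.2.trans h1⟩

/-! Parametric interval Markov chains. -/

/-- A parametric interval Markov chain with state set `S` and parameter set `Y`; the transition
from `s` to `s'` carries the parametric interval `[lo s s', hi s s']`. -/
structure PIMC (A : Type w) (S : Type u) (Y : Type v) where
  init : S
  lo : S → S → RatFn Y
  hi : S → S → RatFn Y
  label : S → Set A

namespace PIMC

variable {A : Type w} {S : Type u} {Y : Type v}

/-- The interval Markov chain obtained from a valuation of the parameters in `[0,1]`. -/
def inst (P : PIMC A S Y) (ν : Y → unitInterval) : IMC A S where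
  init := P.init
  prob s s' := paramInterval (P.lo s s') (P.hi s s') fun y => (ν y : ℝ)
  prob_interval _ _ := paramInterval_ordConnected _ _ _
  prob_subset _ _ := paramInterval_subset _ _ _
  label := P.label

variable [Fintype S]

open Classical in
/-- The states `s'` such that the parametric interval `P(s, s')` is not `[0, 0]`. -/
noncomputable def succ (P : PIMC A S Y) (s : S) : Finset S :=
  Finset.univ.filter fun s' => ¬ (P.lo s s' = 0 ∧ P.hi s s' = 0)

open Classical in
/-- The states `s'` such that the parametric interval `P(s', s)` is not `[0, 0]`. -/
noncomputable def pred (P : PIMC A S Y) (s : S) : Finset S :=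
  Finset.univ.filter fun s' => ¬ (P.lo s' s = 0 ∧ P.hi s' s = 0)

end PIMC

/-- The at-every-step satisfaction relation between Markov chains and parametric interval
Markov chains. -/
def MarkovChain.SatisfiesPIMC {A : Type w} {T S : Type u} {Y : Type v} [Fintype T] [Fintype S]
    (M : MarkovChain A T) (P : PIMC A S Y) : Prop :=
  ∃ ν : Y → unitInterval, M.SatisfiesIMC (P.inst ν)

/-! Constraint satisfaction problems. -/

/-- A constraint satisfaction problem: finitely many variables, a domain for each of them, and a
set of constraints, each given as the predicate on valuations that it expresses. -/
structure CSP where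
  Var : Type u
  finite_var : Finite Var
  Dom : Var → Type
  Cons : Set ((∀ x, Dom x) → Prop)

/-- Some valuation satisfies all the constraints. -/
def CSP.Satisfiable (Ω : CSP.{u}) : Prop :=
  ∃ σ : ∀ x, Ω.Dom x, ∀ c ∈ Ω.Cons, c σ

/-- The problem with one more constraint. -/
def CSP.add (Ω : CSP.{u}) (c : (∀ x, Ω.Dom x) → Prop) : CSP.{u} :=
  { Ω with Cons := Ω.Cons ∪ {c} }

namespace PIMC

variable {A : Type w} {S : Type u} {Y : Type v} [Fintype S]

/-- The variables of the encoding: `π_y` for each parameter (`par`), `θ_s^{s'}` for each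
transition (`theta`), and for each state `ρ_s`, `ω_s`, `λ_s`, `α_s` (`dist`) and `π_s` (`pi`). -/
inductive Var (P : PIMC A S Y) : Type (max u v)
  | par (y : Y)
  | theta (s s' : S) (h : s' ∈ P.succ s)
  | rho (s : S)
  | omega (s : S)
  | lam (s : S)
  | dist (s : S)
  | pi (s : S)

/-- The domains of the variables; `Fin (|S| + 1)` is the set of integers `{0, …, |S|}`. -/
abbrev Dom (P : PIMC A S Y) : P.Var → Type
  | .par _ => unitInterval
  | .theta _ _ _ => unitInterval
  | .rho _ => Bool
  | .omega _ => Fin (Fintype.card S + 1)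
  | .lam _ => Bool
  | .dist _ => Fin (Fintype.card S + 1)
  | .pi _ => unitInterval

theorem finite_var [Finite Y] (P : PIMC A S Y) : Finite P.Var := by
  let f : Y ⊕ (Σ s : S, {s' // s' ∈ P.succ s}) ⊕ S ⊕ S ⊕ S ⊕ S ⊕ S → P.Var
    | .inl y => .par y
    | .inr (.inl q) => .theta q.1 q.2.1 q.2.2
    | .inr (.inr (.inl s)) => .rho s
    | .inr (.inr (.inr (.inl s))) => .omega s
    | .inr (.inr (.inr (.inr (.inl s)))) => .lam s
    | .inr (.inr (.inr (.inr (.inr (.inl s))))) => .dist s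
    | .inr (.inr (.inr (.inr (.inr (.inr s))))) => .pi s
  refine Finite.of_surjective f ?_
  rintro (y | ⟨s, s', h⟩ | s | s | s | s | s)
  · exact ⟨.inl y, rfl⟩
  · exact ⟨.inr (.inl ⟨s, s', h⟩), rfl⟩
  · exact ⟨.inr (.inr (.inl s)), rfl⟩
  · exact ⟨.inr (.inr (.inr (.inl s))), rfl⟩
  · exact ⟨.inr (.inr (.inr (.inr (.inl s)))), rfl⟩
  · exact ⟨.inr (.inr (.inr (.inr (.inr (.inl s))))), rfl⟩
  · exact ⟨.inr (.inr (.inr (.inr (.inr (.inr s))))), rfl⟩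

/-- Valuations of the variables of the encoding. -/
abbrev Valuation (P : PIMC A S Y) : Type (max u v) := ∀ x : P.Var, P.Dom x

namespace Valuation

variable {P : PIMC A S Y}

/-- The value of `π_y`, `y` a parameter. -/
def par (σ : P.Valuation) (y : Y) : unitInterval := σ (.par y)

open Classical in
/-- The value of `θ_s^{s'}` (used below for transitions with `s' ∈ succ s` only). -/
noncomputable def theta (σ : P.Valuation) (s s' : S) : ℝ :=
  if h : s' ∈ P.succ s then ((σ (.theta s s' h) : unitInterval) : ℝ) else 0

/-- `ρ_s` is true. -/
def rho (σ : P.Valuation) (s : S) : Prop := σ (.rho s) = true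

/-- The value of `ω_s`. -/
def omega (σ : P.Valuation) (s : S) : ℕ := (σ (.omega s) : Fin (Fintype.card S + 1)).val

/-- `λ_s` is true. -/
def lam (σ : P.Valuation) (s : S) : Prop := σ (.lam s) = true

/-- The value of the integer variable `α_s`. -/
def dist (σ : P.Valuation) (s : S) : ℕ := (σ (.dist s) : Fin (Fintype.card S + 1)).val

/-- The value of `π_s`, `s` a state. -/
def pi (σ : P.Valuation) (s : S) : ℝ := ((σ (.pi s) : unitInterval) : ℝ)

end Valuation

open Classical in
/-- The consistency constraints. -/
def consistencyCons (P : PIMC A S Y) : Set (P.Valuation → Prop) :=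
  {fun σ => σ.rho P.init} ∪
  {c | ∃ s, c = fun σ => σ.rho s ↔ ∑ s' ∈ P.succ s, σ.theta s s' = 1} ∪
  {c | ∃ s, s ≠ P.init ∧
    c = fun σ => ¬ σ.rho s ↔ ∑ s' ∈ P.pred s \ {s}, σ.theta s' s = 0} ∪
  {c | ∃ s, c = fun σ => ¬ σ.rho s ↔ ∑ s' ∈ P.succ s, σ.theta s s' = 0} ∪
  {c | ∃ s, ∃ s' ∈ P.succ s,
    c = fun σ => σ.rho s → σ.theta s s' ∈ (P.inst σ.par).prob s s'}

open Classical in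
/-- The constraints on reachability from the initial state. -/
def forwardCons (P : PIMC A S Y) : Set (P.Valuation → Prop) :=
  {fun σ => σ.omega P.init = 1} ∪
  {c | ∃ s, s ≠ P.init ∧ c = fun σ => σ.omega s ≠ 1} ∪
  {c | ∃ s, c = fun σ => σ.rho s ↔ σ.omega s ≠ 0} ∪
  {c | ∃ s, s ≠ P.init ∧ c = fun σ => 1 < σ.omega s →
    ∃ s' ∈ P.pred s \ {s}, σ.omega s = σ.omega s' + 1 ∧ 0 < σ.theta s' s} ∪
  {c | ∃ s, s ≠ P.init ∧ c = fun σ => σ.omega s = 0 ↔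
    ∀ s' ∈ P.pred s \ {s}, σ.omega s' = 0 ∨ σ.theta s' s = 0}

open Classical in
/-- The constraints on reachability of the label `α`. -/
def backwardCons (P : PIMC A S Y) (α : Set A) : Set (P.Valuation → Prop) :=
  {c | ∃ s, α = P.label s ∧ c = fun σ => σ.dist s = 1} ∪
  {c | ∃ s, α ≠ P.label s ∧ c = fun σ => σ.dist s ≠ 1} ∪
  {c | ∃ s, c = fun σ => σ.lam s ↔ (σ.rho s ∧ σ.dist s ≠ 0)} ∪
  {c | ∃ s, α ≠ P.label s ∧ c = fun σ => 1 < σ.dist s →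
    ∃ s' ∈ P.succ s \ {s}, σ.dist s = σ.dist s' + 1 ∧ 0 < σ.theta s s'} ∪
  {c | ∃ s, α ≠ P.label s ∧ c = fun σ => σ.dist s = 0 ↔
    ∀ s' ∈ P.succ s \ {s}, σ.dist s' = 0 ∨ σ.theta s s' = 0}

/-- The linear equation system for the reachability probabilities. -/
def probabilityCons (P : PIMC A S Y) (α : Set A) : Set (P.Valuation → Prop) :=
  {c | ∃ s, c = fun σ => ¬ σ.lam s → σ.pi s = 0} ∪
  {c | ∃ s, α = P.label s ∧ c = fun σ => σ.lam s → σ.pi s = 1} ∪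
  {c | ∃ s, α ≠ P.label s ∧ c = fun σ => σ.lam s →
    σ.pi s = ∑ s' ∈ P.succ s, σ.pi s' * σ.theta s s'}

/-- The constraint satisfaction problem encoding quantitative reachability of `α` in `P`. -/
abbrev reachCSP [Finite Y] (P : PIMC A S Y) (α : Set A) : CSP.{max u v} where
  Var := P.Var
  finite_var := P.finite_var
  Dom := P.Dom
  Cons := P.consistencyCons ∪ P.forwardCons ∪ P.backwardCons α ∪ P.probabilityCons α

end PIMC

/-- The four comparison operators. -/
inductive CompOp
  | le
  | lt
  | ge
  | gt

/-- The relation `x ∼ p` on real numbers denoted by a comparison operator. -/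
def CompOp.Rel : CompOp → ℝ → ℝ → Prop
  | .le, x, p => x ≤ p
  | .lt, x, p => x < p
  | .ge, x, p => x ≥ p
  | .gt, x, p => x > p

/-!
A solution of the constraint problem is a Markov chain on the state set `S` of `P`: `θ` gives the
transitions, `ρ` marks the reachable states, and the diagonal relation shows that the chain
satisfies `P`. The ranks `α_s` make the linear equations for `π` uniquely solvable
(`nonpos_of_average`), so `π` at the initial state is the reachability probability
(`PIMC.exists_chain_of_solution`). Conversely a chain on `S` that implements `P` gives a solution,
with shortest-path ranks for `ω` and `α` (`PIMC.exists_solution_of_ofDist`).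

It remains to replace an arbitrary chain `M` satisfying `P`, in which the states related to one
`s` may resolve the intervals at `s` differently, by a chain on `S` whose reachability probability
is at least as large, or at most as large, as the comparison requires (`exists_memoryless`). Pushing
the transitions of a state related to `s` forward along `δ` gives a distribution on `S` that lies
between the interval bounds at `s`. These distributions form a polytope with finitely many vertices,
and linear functions are maximal in a vertex, so it is a matter of comparing `M` with the finitely
many policies that choose a vertex in each state. For a discount factor `γ < 1` a policy that
no vertex improves in one step exists (`exists_optimal_discReach`), and the maximum principle
`nonpos_of_le_discount_mul` shows that it is at least as good as `M`
(`exists_policy_reachProbFrom`). By Abel's theorem the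
discounted values tend to the reachability probabilities as `γ → 1`, and since there are only
finitely many policies the comparison survives in the limit. Working with `γ < 1` avoids the
non-uniqueness of the solutions of the undiscounted equations.

Maximization and minimization are treated together through a factor `ε = ±1`. The second half of
the theorem is the first one for the negated comparison.
-/

/-! ### Ranks in finite directed graphs -/

/-- Every finite directed graph with a set `G` of targets has a rank function: `r s` is one more
than the length of a shortest path from `s` to `G`, and `0` if there is no such path. The values
`1, …, r s` all occur as ranks, whence `r s ≤ |S|`. -/
theorem exists_rank {S : Type*} [Fintype S] (E : S → S → Prop) (G : S → Prop) :
    ∃ r : S → Fin (Fintype.card S + 1),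
      (∀ s, (r s).val = 1 ↔ G s) ∧
      (∀ s, 1 < (r s).val → ∃ s', E s s' ∧ (r s).val = (r s').val + 1) ∧
      (∀ s s', E s s' → (r s').val ≠ 0 → (r s).val ≠ 0) := by
  classical
  -- `Q n s`: some path of length `n` leads from `s` to `G`
  let Q : ℕ → S → Prop := fun n =>
    Nat.rec (motive := fun _ => S → Prop) G (fun _ q s => ∃ s', E s s' ∧ q s') n
  let r : S → ℕ := fun s => if h : ∃ n, Q n s then Nat.find h + 1 else 0
  have r_of : ∀ n s, Q n s → r s ≠ 0 ∧ r s ≤ n + 1 := by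
    intro n s h
    have hex : ∃ n, Q n s := ⟨n, h⟩
    simp only [r, dif_pos hex]
    exact ⟨by omega, by have := Nat.find_min' hex h; omega⟩
  have of_r : ∀ n s, r s = n + 1 → Q n s := by
    intro n s h
    by_cases hex : ∃ n, Q n s
    · simp only [r, dif_pos hex] at h
      obtain rfl : Nat.find hex = n := by omega
      exact Nat.find_spec hex
    · simp [r, dif_neg hex] at h
  have step : ∀ s s', E s s' → r s' ≠ 0 → r s ≠ 0 ∧ r s ≤ r s' + 1 := by
    intro s s' hE h
    obtain ⟨n, hn⟩ := Nat.exists_eq_succ_of_ne_zero h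
    have := r_of (n + 1) s ⟨s', hE, of_r n s' hn⟩
    omega
  have down : ∀ s, 1 < r s → ∃ s', E s s' ∧ r s = r s' + 1 := by
    intro s h
    obtain ⟨n, hn⟩ : ∃ n, r s = n + 1 + 1 := ⟨r s - 2, by omega⟩
    obtain ⟨s', hE, hQ⟩ := of_r _ _ hn
    have h1 := r_of n s' hQ
    have h2 := step s s' hE h1.1
    exact ⟨s', hE, by omega⟩
  have attained : ∀ n s, r s = n → Finset.Icc 1 n ⊆ Finset.univ.image r := by
    intro n
    induction n with
    | zero => simp
    | succ n ih =>
      intro s hs k hk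
      rw [Finset.mem_Icc] at hk
      rcases hk.2.eq_or_lt with rfl | hlt
      · exact Finset.mem_image.2 ⟨s, Finset.mem_univ _, hs⟩
      · obtain ⟨s', -, h'⟩ := down s (by omega)
        exact ih s' (by omega) (Finset.mem_Icc.2 ⟨hk.1, by omega⟩)
  have bound : ∀ s, r s ≤ Fintype.card S := by
    intro s
    have h := (Finset.card_le_card (attained _ s rfl)).trans Finset.card_image_le
    simpa using h
  refine ⟨fun s => ⟨r s, Nat.lt_succ_of_le (bound s)⟩, fun s => ⟨fun h => of_r 0 s h, fun h => ?_⟩,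
    down, fun s s' hE h => (step s s' hE h).1⟩
  have := r_of 0 s h
  change r s = 1
  omega

/-! ### Discounted reachability probabilities -/

namespace MarkovChain

variable {A : Type*} {T : Type*} [Fintype T]

/-- The reachability probability of `α` from `t` with discount factor `γ`: a path of length `n`
counts with weight `γ ^ n`. For `γ = 1` this is `reachProbFrom`. -/
noncomputable def discReach (M : MarkovChain A T) (α : Set A) (γ : ℝ) (t : T) : ℝ :=
  ∑' n : ℕ, (∑ ω ∈ M.firstPaths t α n, M.pathProb ω) * γ ^ n

theorem discReach_one (M : MarkovChain A T) (α : Set A) (t : T) :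
    M.discReach α 1 t = M.reachProbFrom t α := by
  simp [discReach, reachProbFrom]

theorem summable_discReach (M : MarkovChain A T) (α : Set A) {γ : ℝ} (h0 : 0 ≤ γ) (h1 : γ ≤ 1)
    (t : T) : Summable fun n : ℕ => (∑ ω ∈ M.firstPaths t α n, M.pathProb ω) * γ ^ n :=
  (M.summable_firstPaths t α).of_nonneg_of_le
    (fun n => mul_nonneg (M.sum_firstPaths_nonneg t α n) (pow_nonneg h0 n))
    fun n => mul_le_of_le_one_right (M.sum_firstPaths_nonneg t α n) (pow_le_one₀ h0 h1)

theorem discReach_of_label (M : MarkovChain A T) {α : Set A} {γ : ℝ} {t : T}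
    (h : M.label t = α) : M.discReach α γ t = 1 := by
  rw [discReach, tsum_eq_single 0]
  · simp [sum_firstPaths_zero, h]
  · intro n hn
    obtain ⟨n, rfl⟩ := Nat.exists_eq_succ_of_ne_zero hn
    simp [sum_firstPaths_succ, h]

theorem discReach_of_ne (M : MarkovChain A T) {α : Set A} {γ : ℝ} (h0 : 0 ≤ γ) (h1 : γ ≤ 1)
    {t : T} (h : M.label t ≠ α) :
    M.discReach α γ t = γ * ∑ t', M.trans t t' * M.discReach α γ t' := by
  rw [discReach, (M.summable_discReach α h0 h1 t).tsum_eq_zero_add]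
  simp only [sum_firstPaths_zero, sum_firstPaths_succ, if_neg h, zero_mul, zero_add, discReach]
  simp_rw [← tsum_mul_left]
  rw [← Summable.tsum_finsetSum
    fun t' _ => (M.summable_discReach α h0 h1 t').mul_left _, ← tsum_mul_left]
  refine tsum_congr fun n => ?_
  rw [Finset.sum_mul, Finset.mul_sum]
  exact Finset.sum_congr rfl fun t' _ => by ring

theorem reachProbFrom_of_label (M : MarkovChain A T) {α : Set A} {t : T} (h : M.label t = α) :
    M.reachProbFrom t α = 1 := by
  rw [← discReach_one, M.discReach_of_label h]

theorem reachProbFrom_of_ne (M : MarkovChain A T) {α : Set A} {t : T} (h : M.label t ≠ α) :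
    M.reachProbFrom t α = ∑ t', M.trans t t' * M.reachProbFrom t' α := by
  simp_rw [← discReach_one]
  rw [M.discReach_of_ne zero_le_one le_rfl h, one_mul]

theorem reachProbFrom_mem_Icc (M : MarkovChain A T) (α : Set A) (t : T) :
    M.reachProbFrom t α ∈ Set.Icc (0 : ℝ) 1 := by
  refine ⟨tsum_nonneg (M.sum_firstPaths_nonneg t α), ?_⟩
  refine Real.tsum_le_of_sum_range_le (M.sum_firstPaths_nonneg t α) fun N => ?_
  induction N generalizing t with
  | zero => simp
  | succ N ih =>
    rw [Finset.sum_range_succ']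
    simp_rw [sum_firstPaths_succ, sum_firstPaths_zero]
    split_ifs with h
    · simp
    · rw [add_zero, Finset.sum_comm, ← M.trans_sum t]
      refine Finset.sum_le_sum fun t' _ => ?_
      rw [← Finset.mul_sum]
      exact mul_le_of_le_one_right (M.trans_nonneg _ _) (ih t')

/-- The reachability probability vanishes on a set of states without label `α` that the chain
does not leave. -/
theorem reachProbFrom_eq_zero (M : MarkovChain A T) {α : Set A} (Z : T → Prop)
    (hlabel : ∀ t, Z t → M.label t ≠ α) (hstep : ∀ t t', Z t → 0 < M.trans t t' → Z t')
    {t : T} (ht : Z t) : M.reachProbFrom t α = 0 := by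
  have key : ∀ n t, Z t → ∑ ω ∈ M.firstPaths t α n, M.pathProb ω = 0 := by
    intro n
    induction n with
    | zero => intro t ht; rw [sum_firstPaths_zero, if_neg (hlabel t ht)]
    | succ n ih =>
      intro t ht
      rw [sum_firstPaths_succ, if_neg (hlabel t ht)]
      refine Finset.sum_eq_zero fun t' _ => ?_
      rcases (M.trans_nonneg t t').eq_or_lt with h | h
      · rw [← h, zero_mul]
      · rw [ih t' (hstep t t' ht h), mul_zero]
  simp [reachProbFrom, key _ t ht]

open Filter Topology in
theorem tendsto_discReach (M : MarkovChain A T) (α : Set A) (t : T) :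
    Tendsto (fun γ => M.discReach α γ t) (𝓝[<] 1) (𝓝 (M.reachProbFrom t α)) :=
  Real.tendsto_tsum_powerSeries_nhdsWithin_lt
    (M.summable_firstPaths t α).hasSum.tendsto_sum_nat

end MarkovChain

/-! ### Vertices of a box intersected with the probability simplex -/

section Vertices

variable {S : Type*} [Fintype S]

/-- The distributions on `S` that lie between the bounds `a` and `b` (these are probability
distributions as soon as `a` is nonnegative). -/
def boxDist (a b : S → ℝ) : Set (S → ℝ) :=
  {d | d ∈ Set.Icc a b ∧ ∑ i, d i = 1}

theorem isCompact_boxDist (a b : S → ℝ) : IsCompact (boxDist a b) :=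
  isCompact_Icc.inter_right (isClosed_eq (by fun_prop) continuous_const)

/-- A vertex has at most one coordinate strictly between its bounds: with two of them, mass could
be moved between the two coordinates in both directions. -/
theorem eq_of_mem_extremePoints_boxDist {a b d : S → ℝ} (hd : d ∈ (boxDist a b).extremePoints ℝ)
    {i j : S} (hi : d i ≠ a i ∧ d i ≠ b i) (hj : d j ≠ a j ∧ d j ≠ b j) : i = j := by
  classical
  by_contra hij
  obtain ⟨⟨⟨hda, hdb⟩, hsum⟩, hext⟩ := hd
  have h1 := lt_of_le_of_ne (hda i) hi.1.symm
  have h2 := lt_of_le_of_ne (hdb i) hi.2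
  have h3 := lt_of_le_of_ne (hda j) hj.1.symm
  have h4 := lt_of_le_of_ne (hdb j) hj.2
  obtain ⟨ε, hε, hεlt⟩ : ∃ ε > 0, ε < min (min (d i - a i) (b i - d i))
      (min (d j - a j) (b j - d j)) := by
    apply exists_between
    simp only [lt_min_iff, sub_pos]
    exact ⟨⟨h1, h2⟩, h3, h4⟩
  simp only [lt_min_iff] at hεlt
  obtain ⟨⟨e1, e2⟩, e3, e4⟩ := hεlt
  let w : S → ℝ := Pi.single i 1 - Pi.single j 1
  have wi : w i = 1 := by simp [w, hij]
  have wj : w j = -1 := by simp [w, Ne.symm hij]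
  have wk : ∀ k, k ≠ i → k ≠ j → w k = 0 := by intro k h h'; simp [w, h, h']
  have wsum : ∑ k, w k = 0 := by simp [w, Finset.sum_sub_distrib]
  have mem : ∀ c : ℝ, |c| ≤ ε → d + c • w ∈ boxDist a b := by
    intro c hc
    obtain ⟨hc1, hc2⟩ := abs_le.1 hc
    have both : ∀ k, a k ≤ (d + c • w) k ∧ (d + c • w) k ≤ b k := by
      intro k
      simp only [Pi.add_apply, Pi.smul_apply, smul_eq_mul]
      by_cases hki : k = i
      · subst hki; rw [wi]; constructor <;> linarith
      by_cases hkj : k = j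
      · subst hkj; rw [wj]; constructor <;> linarith
      rw [wk k hki hkj, mul_zero, add_zero]
      exact ⟨hda k, hdb k⟩
    refine ⟨⟨fun k => (both k).1, fun k => (both k).2⟩, ?_⟩
    simp only [Pi.add_apply, Pi.smul_apply, smul_eq_mul, Finset.sum_add_distrib, ← Finset.mul_sum,
      wsum, hsum, mul_zero, add_zero]
  have hseg : d ∈ openSegment ℝ (d + ε • w) (d + (-ε) • w) := by
    refine ⟨1 / 2, 1 / 2, by norm_num, by norm_num, by norm_num, ?_⟩
    ext k
    simp only [Pi.add_apply, Pi.smul_apply, smul_eq_mul]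
    ring
  have h := congrFun (hext (mem ε (abs_of_pos hε).le) (mem (-ε) (by rw [abs_neg, abs_of_pos hε]))
    hseg) i
  simp only [Pi.add_apply, Pi.smul_apply, smul_eq_mul, wi] at h
  linarith

/-- A vertex is determined by the coordinates at which it meets its lower and upper bounds. -/
theorem finite_extremePoints_boxDist (a b : S → ℝ) :
    ((boxDist a b).extremePoints ℝ).Finite := by
  classical
  refine Set.Finite.of_finite_image (f := fun d i => ((d i = a i, d i = b i) : Prop × Prop))
    (Set.toFinite _) ?_
  intro d hd d' hd' h
  have hab : ∀ i, (d i = a i ↔ d' i = a i) ∧ (d i = b i ↔ d' i = b i) := by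
    intro i
    have := congrFun h i
    simpa [Prod.ext_iff] using this
  have fixed : ∀ i, (d i = a i ∨ d i = b i) → d i = d' i := by
    rintro i (hi | hi)
    · rw [hi, (hab i).1.1 hi]
    · rw [hi, (hab i).2.1 hi]
  ext i
  by_cases hi : d i = a i ∨ d i = b i
  · exact fixed i hi
  -- `i` is then the only free coordinate, and the total mass determines its value
  have hrest : ∑ k ∈ Finset.univ.erase i, d k = ∑ k ∈ Finset.univ.erase i, d' k := by
    refine Finset.sum_congr rfl fun k hk => fixed k ?_
    by_contra hk'
    exact Finset.ne_of_mem_erase hk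
      (eq_of_mem_extremePoints_boxDist hd (not_or.1 hk') (not_or.1 hi))
  have s1 := Finset.add_sum_erase Finset.univ d (Finset.mem_univ i)
  have s2 := Finset.add_sum_erase Finset.univ d' (Finset.mem_univ i)
  rw [hd.1.2] at s1
  rw [hd'.1.2] at s2
  linarith

/-- A linear function attains its maximum over `boxDist a b` in a vertex. -/
theorem exists_extremePoint_boxDist_ge {a b d : S → ℝ} (hd : d ∈ boxDist a b) (x : S → ℝ) :
    ∃ c ∈ (boxDist a b).extremePoints ℝ, ∑ i, d i * x i ≤ ∑ i, c i * x i := by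
  let l : (S → ℝ) →L[ℝ] ℝ := ∑ i, x i • ContinuousLinearMap.proj i
  have hl : ∀ c, l c = ∑ i, c i * x i := by
    intro c
    simp [l, mul_comm]
  have hexp : IsExposed ℝ (boxDist a b) (l.toExposed (boxDist a b)) :=
    ContinuousLinearMap.toExposed.isExposed
  obtain ⟨m, hm, hmax⟩ := (isCompact_boxDist a b).exists_isMaxOn ⟨d, hd⟩ l.continuous.continuousOn
  obtain ⟨c, hc⟩ := (hexp.isCompact (isCompact_boxDist a b)).extremePoints_nonempty
    ⟨m, hm, fun y hy => hmax hy⟩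
  refine ⟨c, hexp.isExtreme.extremePoints_subset_extremePoints hc, ?_⟩
  rw [← hl, ← hl]
  exact hc.1.2 d hd

end Vertices

/-! ### Optimal memoryless policies -/

/-- The Markov chain whose transition distributions are given by `c`. -/
def MarkovChain.ofDist {A S : Type*} [Fintype S] (s₀ : S) (label : S → Set A) (c : S → S → ℝ)
    (hc : ∀ s, c s ∈ stdSimplex ℝ S) : MarkovChain A S where
  init := s₀
  trans := c
  trans_nonneg s := (hc s).1
  trans_sum s := (hc s).2
  label := label

/-- The maximum principle behind the comparison of discounted reachability probabilities: if
every nonnegative bound `m` of `u` improves to `γ * m`, with `γ < 1`, then `u ≤ 0`. -/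
theorem nonpos_of_le_discount_mul {I : Type*} [Finite I] {γ : ℝ} (h1 : γ < 1) {u : I → ℝ}
    (h : ∀ m, 0 ≤ m → (∀ j, u j ≤ m) → ∀ i, u i ≤ γ * m) (i : I) : u i ≤ 0 := by
  have : Nonempty I := ⟨i⟩
  obtain ⟨k, hk⟩ := Finite.exists_max u
  by_contra! hi
  have hpos := hi.trans_le (hk i)
  have := h (u k) hpos.le hk k
  nlinarith

/-- An average of numbers `x j ≤ m` is at most `m`; only the `x j` of positive weight matter. -/
theorem sum_mul_le_of_weights {I : Type*} [Fintype I] {w x : I → ℝ} {m : ℝ}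
    (hw : ∀ j, 0 ≤ w j) (hsum : ∑ j, w j = 1) (hx : ∀ j, 0 < w j → x j ≤ m) :
    ∑ j, w j * x j ≤ m := by
  calc ∑ j, w j * x j ≤ ∑ j, w j * m := by
        refine Finset.sum_le_sum fun j _ => ?_
        rcases (hw j).eq_or_lt with h | h
        · simp [← h]
        · exact mul_le_mul_of_nonneg_left (hx j h) h.le
    _ = m := by rw [← Finset.sum_mul, hsum, one_mul]

section Policy

variable {A S : Type*} [Fintype S] {V : S → Set (S → ℝ)}

/-- Among finitely many distributions per state, some choice of one distribution in each state
is optimal for the discounted reachability probability: no other distribution improves it in one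
step. The factor `ε` selects maximization (`ε = 1`) or minimization (`ε = -1`). -/
theorem exists_optimal_discReach (s₀ : S) (label : S → Set A) (α : Set A)
    (hfin : ∀ s, (V s).Finite) (hne : ∀ s, (V s).Nonempty) (hV : ∀ s, V s ⊆ stdSimplex ℝ S)
    (ε : ℝ) {γ : ℝ} (h0 : 0 ≤ γ) (h1 : γ < 1) :
    ∃ c : ∀ s, V s, ∀ s, label s ≠ α → ∀ d ∈ V s,
      ε * (γ * ∑ s', d s' *
        (MarkovChain.ofDist s₀ label (fun s => (c s : S → ℝ)) fun s => hV s (c s).2).discReach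
          α γ s') ≤
      ε * (MarkovChain.ofDist s₀ label (fun s => (c s : S → ℝ)) fun s => hV s (c s).2).discReach
        α γ s := by
  have : ∀ s, Finite (V s) := fun s => (hfin s).to_subtype
  have : ∀ s, Nonempty (V s) := fun s => (hne s).to_subtype
  let N : (∀ s, V s) → MarkovChain A S := fun c =>
    MarkovChain.ofDist s₀ label (fun s => (c s : S → ℝ)) fun s => hV s (c s).2
  let x : (∀ s, V s) → S → ℝ := fun c s => (N c).discReach α γ s
  have x_goal : ∀ c s, label s = α → x c s = 1 := fun c s h => (N c).discReach_of_label h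
  have x_step : ∀ c s, label s ≠ α → x c s = γ * ∑ s', (c s : S → ℝ) s' * x c s' :=
    fun c s h => (N c).discReach_of_ne h0 h1.le h
  obtain ⟨c, hc⟩ := Finite.exists_max fun c : ∀ s, V s => ∑ s, ε * x c s
  refine ⟨c, ?_⟩
  -- a policy that is greedy with respect to the values of `c` is at least as good everywhere
  have greedy : ∀ s, ∃ d : V s, ∀ d' : V s,
      ε * ∑ s', (d' : S → ℝ) s' * x c s' ≤ ε * ∑ s', (d : S → ℝ) s' * x c s' :=
    fun s => Finite.exists_max _
  choose g hg using greedy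
  have improve : ∀ s, ε * x c s ≤ ε * x g s := by
    intro s
    rw [← sub_nonpos]
    refine nonpos_of_le_discount_mul (u := fun s => ε * x c s - ε * x g s) h1 ?_ s
    intro m hm hle s
    by_cases hs : label s = α
    · simp only [x_goal _ _ hs, sub_self]
      positivity
    have h2 : ∑ s', (g s : S → ℝ) s' * (ε * x c s' - ε * x g s') ≤ m :=
      sum_mul_le_of_weights (hV s (g s).2).1 (hV s (g s).2).2 fun s' _ => hle s'
    have h3 : ∑ s', (g s : S → ℝ) s' * (ε * x c s' - ε * x g s') =
        ε * ∑ s', (g s : S → ℝ) s' * x c s' - ε * ∑ s', (g s : S → ℝ) s' * x g s' := by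
      rw [Finset.mul_sum, Finset.mul_sum, ← Finset.sum_sub_distrib]
      exact Finset.sum_congr rfl fun s' _ => by ring
    have h4 := mul_le_mul_of_nonneg_left (hg s (c s)) h0
    have h5 := mul_le_mul_of_nonneg_left h2 h0
    rw [h3] at h5
    simp only [x_step _ _ hs]
    linarith
  -- by the choice of `c` the two policies then have the same values
  have same : ∀ s, ε * x c s = ε * x g s := by
    have h := (Finset.sum_le_sum fun s _ => improve s).antisymm (hc g)
    exact fun s => (Finset.sum_eq_sum_iff_of_le fun s _ => improve s).1 h s (Finset.mem_univ s)
  intro s hs d hd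
  have h2 : ε * ∑ s', (g s : S → ℝ) s' * x c s' = ε * ∑ s', (g s : S → ℝ) s' * x g s' := by
    rw [Finset.mul_sum, Finset.mul_sum]
    refine Finset.sum_congr rfl fun s' _ => ?_
    rw [mul_left_comm, same s', mul_left_comm]
  have h3 := mul_le_mul_of_nonneg_left (hg s ⟨d, hd⟩) h0
  calc ε * (γ * ∑ s', d s' * x c s') = γ * (ε * ∑ s', d s' * x c s') := by ring
    _ ≤ γ * (ε * ∑ s', (g s : S → ℝ) s' * x c s') := h3
    _ = ε * (γ * ∑ s', (g s : S → ℝ) s' * x g s') := by rw [h2]; ring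
    _ = ε * x g s := by rw [x_step g s hs]
    _ = ε * x c s := (same s).symm

variable {T : Type*} [Fintype T]

/-- A chain `M` whose states `t` simulate, through `R`, moves with distributions that are
dominated by those in `V s`, does not beat all the memoryless policies choosing from `V`. Since
there are finitely many policies, the comparison for discount factors `γ < 1` passes to the limit
`γ → 1`. -/
theorem exists_policy_reachProbFrom (M : MarkovChain A T) (s₀ : S) (label : S → Set A) (α : Set A)
    (hfin : ∀ s, (V s).Finite) (hne : ∀ s, (V s).Nonempty) (hV : ∀ s, V s ⊆ stdSimplex ℝ S)
    (R : T → S → Prop) (hR : ∀ t s, R t s → M.label t = label s ∧ ∃ δ : T → S → ℝ,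
      (∀ t' s', 0 ≤ δ t' s') ∧ (∀ t', 0 < M.trans t t' → ∑ s', δ t' s' = 1) ∧
      (∀ t' s', 0 < δ t' s' → R t' s') ∧
      ∀ x : S → ℝ, ∃ d ∈ V s,
        ∑ s', (∑ t', M.trans t t' * δ t' s') * x s' ≤ ∑ s', d s' * x s')
    (ε : ℝ) {t₀ : T} (ht₀ : R t₀ s₀) :
    ∃ c : ∀ s, V s, ε * M.reachProbFrom t₀ α ≤
      ε * (MarkovChain.ofDist s₀ label (fun s => (c s : S → ℝ))
        fun s => hV s (c s).2).reachProbFrom s₀ α := by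
  have : ∀ s, Finite (V s) := fun s => (hfin s).to_subtype
  let N : (∀ s, V s) → MarkovChain A S := fun c =>
    MarkovChain.ofDist s₀ label (fun s => (c s : S → ℝ)) fun s => hV s (c s).2
  have disc : ∀ γ : ℝ, 0 ≤ γ → γ < 1 →
      ∃ c, ε * M.discReach α γ t₀ ≤ ε * (N c).discReach α γ s₀ := by
    intro γ h0 h1
    obtain ⟨c, hc⟩ := exists_optimal_discReach s₀ label α hfin hne hV ε h0 h1
    refine ⟨c, ?_⟩
    let x : S → ℝ := fun s => (N c).discReach α γ s
    rw [← sub_nonpos]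
    refine nonpos_of_le_discount_mul (I := {q : T × S // R q.1 q.2})
      (u := fun q => ε * M.discReach α γ q.1.1 - ε * x q.1.2) h1 ?_ ⟨(t₀, s₀), ht₀⟩
    rintro m hm hle ⟨⟨t, s⟩, hts⟩
    obtain ⟨hlab, δ, hδ0, hδ1, hδR, hdom⟩ := hR t s hts
    by_cases hs : label s = α
    · have e1 : M.discReach α γ t = 1 := M.discReach_of_label (hlab.trans hs)
      have e2 : x s = 1 := (N c).discReach_of_label hs
      simp only [e1, e2, sub_self]
      positivity
    obtain ⟨d, hd, hdx⟩ := hdom fun s' => ε * x s'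
    have opt := hc s hs d hd
    have hrow : ∀ t', 0 < M.trans t t' →
        ∑ s', δ t' s' * (ε * M.discReach α γ t' - ε * x s') ≤ m := fun t' ht' =>
      sum_mul_le_of_weights (hδ0 t') (hδ1 t' ht') fun s' h => hle ⟨(t', s'), hδR t' s' h⟩
    have htot := sum_mul_le_of_weights (M.trans_nonneg t) (M.trans_sum t) hrow
    have expand : ∑ t', M.trans t t' * ∑ s', δ t' s' * (ε * M.discReach α γ t' - ε * x s') =
        ε * ∑ t', M.trans t t' * M.discReach α γ t' -
          ∑ s', (∑ t', M.trans t t' * δ t' s') * (ε * x s') := by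
      have e1 : ∑ s', (∑ t', M.trans t t' * δ t' s') * (ε * x s') =
          ∑ t', ∑ s', M.trans t t' * δ t' s' * (ε * x s') := by
        simp_rw [Finset.sum_mul]
        exact Finset.sum_comm
      rw [e1, Finset.mul_sum, ← Finset.sum_sub_distrib]
      refine Finset.sum_congr rfl fun t' _ => ?_
      rcases (M.trans_nonneg t t').eq_or_lt with h | h
      · simp [← h]
      simp_rw [mul_sub]
      rw [Finset.sum_sub_distrib, ← Finset.sum_mul, hδ1 t' h, mul_sub, one_mul, Finset.mul_sum]
      congr 1
      · ring
      · exact Finset.sum_congr rfl fun s' _ => by ring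
    rw [expand] at htot
    have e3 : ∑ s', d s' * (ε * x s') = ε * ∑ s', d s' * x s' := by
      rw [Finset.mul_sum]
      exact Finset.sum_congr rfl fun s' _ => by ring
    rw [e3] at hdx
    have h6 := mul_le_mul_of_nonneg_left (htot.trans' (sub_le_sub_left hdx _)) h0
    have e4 := M.discReach_of_ne h0 h1.le (hlab.trans_ne hs)
    simp only [e4]
    have opt' : ε * (γ * ∑ s', d s' * x s') ≤ ε * x s := opt
    linarith
  by_contra! hcon
  open Filter Topology in
  have ev : ∀ᶠ γ in 𝓝[<] (1 : ℝ), ∀ c, ε * (N c).discReach α γ s₀ < ε * M.discReach α γ t₀ :=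
    eventually_all.2 fun c =>
      (((N c).tendsto_discReach α s₀).const_mul ε).eventually_lt
        ((M.tendsto_discReach α t₀).const_mul ε) (hcon c)
  obtain ⟨γ, hγ, h0, h1⟩ := (ev.and (Ioo_mem_nhdsLT zero_lt_one)).exists
  obtain ⟨c, hc⟩ := disc γ h0.le h1
  exact (hγ c).not_ge hc

end Policy

/-! ### Memoryless implementations of interval Markov chains -/

theorem paramInterval_eq_Icc_of_mem {Y : Type*} {f₁ f₂ : RatFn Y} {v : Y → ℝ} {x : ℝ}
    (hx : x ∈ paramInterval f₁ f₂ v) :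
    ∃ a b : ℝ, 0 ≤ a ∧ paramInterval f₁ f₂ v = Set.Icc a b := by
  obtain ⟨a, b, ha, hb, h0, hab, h1, -⟩ := hx
  refine ⟨a, b, h0, Set.ext fun y => ⟨?_, fun hy => ⟨a, b, ha, hb, h0, hab, h1, hy⟩⟩⟩
  rintro ⟨a', b', ha', hb', -, -, -, hy⟩
  rwa [ha.unique ha', hb.unique hb']

theorem eq_zero_of_mem_paramInterval_zero {Y : Type*} {v : Y → ℝ} {x : ℝ}
    (hx : x ∈ paramInterval 0 0 v) : x = 0 := by
  have hz : RatHasValue (0 : RatFn Y) v 0 := ⟨0, 1, by simp, by simp, by simp⟩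
  obtain ⟨a, b, ha, hb, -, -, -, hx⟩ := hx
  rw [ha.unique hz, hb.unique hz] at hx
  exact le_antisymm hx.2 hx.1

theorem zero_mem_paramInterval_zero {Y : Type*} (v : Y → ℝ) : (0 : ℝ) ∈ paramInterval 0 0 v := by
  have hz : RatHasValue (0 : RatFn Y) v 0 := ⟨0, 1, by simp, by simp, by simp⟩
  exact ⟨0, 0, hz, hz, le_rfl, le_rfl, zero_le_one, le_rfl, le_rfl⟩

/-- A chain satisfying `P` has a counterpart with state set `S` that resolves the intervals by
one distribution per state, and whose reachability probability is at least (`ε = 1`) or at most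
(`ε = -1`) that of the given chain. The set `W` consists of the states of `P` that are used. -/
theorem exists_memoryless {A : Type w} {S T : Type u} {Y : Type v} [Fintype S] [Fintype T]
    (P : PIMC A S Y)
    (ν : Y → unitInterval) (M : MarkovChain A T) (hM : M.SatisfiesIMC (P.inst ν)) (α : Set A)
    (ε : ℝ) :
    ∃ (W : S → Prop) (c : S → S → ℝ) (hc : ∀ s, c s ∈ stdSimplex ℝ S), W P.init ∧
      (∀ s, W s → ∀ s', c s s' ∈ (P.inst ν).prob s s') ∧
      (∀ s, W s → ∀ s', c s s' ≠ 0 → W s') ∧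
      ε * M.reachProb α ≤ ε * (MarkovChain.ofDist P.init P.label c hc).reachProb α := by
  classical
  obtain ⟨R, hinit, hR⟩ := hM
  let W : S → Prop := fun s => ∃ t, R t s
  have bounds : ∀ s, ∃ ab : (S → ℝ) × (S → ℝ), W s → ∀ s',
      0 ≤ ab.1 s' ∧ (P.inst ν).prob s s' = Set.Icc (ab.1 s') (ab.2 s') := by
    intro s
    by_cases hs : W s
    · obtain ⟨t, ht⟩ := hs
      obtain ⟨-, δ, -, -, hprob, -⟩ := hR t s ht
      choose a b hab using fun s' => paramInterval_eq_Icc_of_mem (hprob s')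
      exact ⟨(a, b), fun _ => hab⟩
    · exact ⟨0, fun h => absurd h hs⟩
  choose ab hab using bounds
  -- the interval bounds, sharpened so that no mass leaves `W`
  let a : S → S → ℝ := fun s s' => if W s' then (ab s).1 s' else 0
  let b : S → S → ℝ := fun s s' => if W s' then (ab s).2 s' else 0
  let V : S → Set (S → ℝ) := fun s =>
    if W s then (boxDist (a s) (b s)).extremePoints ℝ else {Pi.single s 1}
  have marg : ∀ t s, R t s → M.label t = P.label s ∧ ∃ δ : T → S → ℝ,
      (∀ t' s', 0 ≤ δ t' s') ∧ (∀ t', 0 < M.trans t t' → ∑ s', δ t' s' = 1) ∧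
      (∀ t' s', 0 < δ t' s' → R t' s') ∧
      (fun s' => ∑ t', M.trans t t' * δ t' s') ∈ boxDist (a s) (b s) ∧
      ∀ s', ¬ W s' → (0 : ℝ) ∈ (P.inst ν).prob s s' := by
    intro t s hts
    obtain ⟨hlab, δ, hδ01, hδ1, hprob, hδR⟩ := hR t s hts
    have hzero : ∀ s', ¬ W s' → ∑ t', M.trans t t' * δ t' s' = 0 := by
      intro s' hs'
      refine Finset.sum_eq_zero fun t' _ => ?_
      rcases (hδ01 t' s').1.eq_or_lt with h | h
      · rw [← h, mul_zero]
      · exact absurd ⟨t', hδR t' s' h⟩ hs'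
    have both : ∀ s', a s s' ≤ ∑ t', M.trans t t' * δ t' s' ∧
        ∑ t', M.trans t t' * δ t' s' ≤ b s s' := by
      intro s'
      by_cases hs' : W s'
      · have h := hprob s'
        rw [(hab s ⟨t, hts⟩ s').2] at h
        simp only [a, b, if_pos hs']
        exact h
      · simp only [a, b, if_neg hs', hzero s' hs', le_refl, and_self]
    refine ⟨hlab, δ, fun t' s' => (hδ01 t' s').1, hδ1, hδR,
      ⟨⟨fun s' => (both s').1, fun s' => (both s').2⟩, ?_⟩, fun s' hs' => ?_⟩
    · rw [Finset.sum_comm, ← M.trans_sum t]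
      refine Finset.sum_congr rfl fun t' _ => ?_
      rcases (M.trans_nonneg t t').eq_or_lt with h | h
      · simp [← h]
      · rw [← Finset.mul_sum, hδ1 t' h, mul_one]
    · rw [← hzero s' hs']
      exact hprob s'
  have hfin : ∀ s, (V s).Finite := by
    intro s
    by_cases hs : W s
    · simpa only [V, if_pos hs] using finite_extremePoints_boxDist (a s) (b s)
    · simp only [V, if_neg hs, Set.finite_singleton]
  have hne : ∀ s, (V s).Nonempty := by
    intro s
    by_cases hs : W s
    · obtain ⟨t, ht⟩ := hs
      obtain ⟨-, δ, -, -, -, hd, -⟩ := marg t s ht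
      obtain ⟨c, hc, -⟩ := exists_extremePoint_boxDist_ge hd 0
      have hs : W s := ⟨t, ht⟩
      exact ⟨c, by simpa only [V, if_pos hs] using hc⟩
    · simp only [V, if_neg hs, Set.singleton_nonempty]
  have hbox : ∀ s, W s → V s ⊆ boxDist (a s) (b s) := by
    intro s hs
    simpa only [V, if_pos hs] using extremePoints_subset
  have hV : ∀ s, V s ⊆ stdSimplex ℝ S := by
    intro s
    by_cases hs : W s
    · intro d hd
      obtain ⟨⟨hda, -⟩, hsum⟩ := hbox s hs hd
      refine ⟨fun s' => le_trans ?_ (hda s'), hsum⟩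
      simp only [a]
      split_ifs
      exacts [(hab s hs s').1, le_rfl]
    · simp only [V, if_neg hs, Set.singleton_subset_iff]
      exact single_mem_stdSimplex ℝ s
  obtain ⟨c, hc⟩ := exists_policy_reachProbFrom (V := V) M P.init P.label α hfin hne hV R
    (by
      intro t s hts
      obtain ⟨hlab, δ, h0, h1, h2, hd, -⟩ := marg t s hts
      have hs : W s := ⟨t, hts⟩
      refine ⟨hlab, δ, h0, h1, h2, fun x => ?_⟩
      simpa only [V, if_pos hs] using exists_extremePoint_boxDist_ge hd x) ε hinit
  refine ⟨W, fun s => c s, fun s => hV s (c s).2, ⟨_, hinit⟩, ?_, ?_, hc⟩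
  · intro s hs s'
    obtain ⟨⟨hda, hdb⟩, -⟩ := hbox s hs (c s).2
    have h1 := hda s'
    have h2 := hdb s'
    by_cases hs' : W s'
    · simp only [a, b, if_pos hs'] at h1 h2
      rw [(hab s hs s').2]
      exact ⟨h1, h2⟩
    · simp only [a, b, if_neg hs'] at h1 h2
      obtain ⟨t, ht⟩ := hs
      obtain ⟨-, -, -, -, -, -, hz⟩ := marg t s ht
      change (c s : S → ℝ) s' ∈ _
      rw [le_antisymm h2 h1]
      exact hz s' hs'
  · intro s hs s' hne
    by_contra hs'
    obtain ⟨⟨hda, hdb⟩, -⟩ := hbox s hs (c s).2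
    have h1 := hda s'
    have h2 := hdb s'
    simp only [a, b, if_neg hs'] at h1 h2
    exact hne (le_antisymm h2 h1)

/-! ### From chains to solutions of the constraint problem -/

namespace PIMC

theorem mem_pred_iff {A : Type*} {S : Type*} {Y : Type*} [Fintype S] {P : PIMC A S Y} {s s' : S} :
    s' ∈ P.pred s ↔ s ∈ P.succ s' := by
  simp [pred, succ]

theorem eq_zero_of_notMem_succ {A : Type*} {S : Type*} {Y : Type*} [Fintype S] {P : PIMC A S Y}
    {ν : Y → unitInterval} {s s' : S} {x : ℝ} (h : s' ∉ P.succ s)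
    (hx : x ∈ (P.inst ν).prob s s') : x = 0 := by
  simp only [succ, Finset.mem_filter, Finset.mem_univ, true_and, not_not] at h
  simp only [inst, h.1, h.2] at hx
  exact eq_zero_of_mem_paramInterval_zero hx

theorem zero_mem_prob_of_notMem_succ {A : Type*} {S : Type*} {Y : Type*} [Fintype S]
    {P : PIMC A S Y} (ν : Y → unitInterval) {s s' : S} (h : s' ∉ P.succ s) :
    (0 : ℝ) ∈ (P.inst ν).prob s s' := by
  simp only [succ, Finset.mem_filter, Finset.mem_univ, true_and, not_not] at h
  simp only [inst, h.1, h.2]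
  exact zero_mem_paramInterval_zero _

variable {A : Type w} {S : Type u} {Y : Type v} [Fintype S]

/-- A chain with state set `S` that resolves the intervals of `P` on a set `W` of states closed
under its transitions gives a solution: `θ` is its transition function on the reachable states
and `0` elsewhere, and `ω`, `α` are ranks with respect to the initial state and to the label. -/
theorem exists_solution_of_ofDist [Finite Y] (P : PIMC A S Y) (α : Set A) (ν : Y → unitInterval)
    (W : S → Prop) (c : S → S → ℝ) (hc : ∀ s, c s ∈ stdSimplex ℝ S) (hinit : W P.init)
    (hprob : ∀ s, W s → ∀ s', c s s' ∈ (P.inst ν).prob s s')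
    (hW : ∀ s, W s → ∀ s', c s s' ≠ 0 → W s') :
    ∃ σ : P.Valuation, (∀ k ∈ (P.reachCSP α).Cons, k σ) ∧
      σ.pi P.init = (MarkovChain.ofDist P.init P.label c hc).reachProb α := by
  classical
  let N := MarkovChain.ofDist P.init P.label c hc
  have c0 : ∀ s s', 0 ≤ c s s' := fun s => (hc s).1
  have c1 : ∀ s, ∑ s', c s s' = 1 := fun s => (hc s).2
  have cle : ∀ s s', c s s' ≤ 1 := fun s s' => by
    rw [← c1 s]
    exact Finset.single_le_sum (fun i _ => c0 s i) (Finset.mem_univ s')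
  obtain ⟨om, om_one, om_down, om_step⟩ := exists_rank (fun s s' => 0 < c s' s) (· = P.init)
  have omW : ∀ n s, (om s).val = n + 1 → W s := by
    intro n
    induction n with
    | zero => intro s hs; rw [(om_one s).1 hs]; exact hinit
    | succ n ih =>
      intro s hs
      obtain ⟨s', h, h'⟩ := om_down s (by omega)
      exact hW s' (ih s' (by omega)) s h.ne'
  have om_W : ∀ s, (om s).val ≠ 0 → W s := fun s hs => omW _ s (Nat.succ_pred_eq_of_ne_zero hs).symm
  let θ : S → S → ℝ := fun s s' => if (om s).val ≠ 0 then c s s' else 0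
  have θ_pos : ∀ s s', (om s).val ≠ 0 → θ s s' = c s s' := fun s s' h => if_pos h
  have θ_zero : ∀ s s', (om s).val = 0 → θ s s' = 0 := fun s s' h => if_neg (not_not.2 h)
  have θ0 : ∀ s s', 0 ≤ θ s s' := by
    intro s s'
    simp only [θ]
    split_ifs
    exacts [c0 s s', le_rfl]
  have θle : ∀ s s', θ s s' ≤ 1 := by
    intro s s'
    simp only [θ]
    split_ifs
    exacts [cle s s', zero_le_one]
  have θ_succ : ∀ s s', s' ∉ P.succ s → θ s s' = 0 := by
    intro s s' h
    by_cases hs : (om s).val = 0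
    · exact θ_zero s s' hs
    · rw [θ_pos s s' hs]
      exact eq_zero_of_notMem_succ h (hprob s (om_W s hs) s')
  have succ_of : ∀ s s', 0 < θ s s' → s' ∈ P.succ s := fun s s' h => by
    by_contra h'
    exact h.ne' (θ_succ s s' h')
  have sum_succ : ∀ s, ∀ f : S → ℝ, ∑ s' ∈ P.succ s, f s' * θ s s' = ∑ s', f s' * θ s s' := by
    intro s f
    refine Finset.sum_subset (Finset.subset_univ _) fun s' _ h => ?_
    rw [θ_succ s s' h, mul_zero]
  have om_of_θ : ∀ s s', 0 < θ s s' → (om s).val ≠ 0 ∧ (om s').val ≠ 0 := by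
    intro s s' h
    have hs : (om s).val ≠ 0 := fun h0 => h.ne' (θ_zero s s' h0)
    rw [θ_pos s s' hs] at h
    exact ⟨hs, om_step s' s h hs⟩
  obtain ⟨di, di_one, di_down, di_step⟩ :=
    exists_rank (fun s s' => 0 < θ s s') (fun s => P.label s = α)
  have reach_zero : ∀ s, (om s).val ≠ 0 → (di s).val = 0 → N.reachProbFrom s α = 0 := by
    intro s h h'
    refine N.reachProbFrom_eq_zero (fun s => (om s).val ≠ 0 ∧ (di s).val = 0) ?_ ?_ ⟨h, h'⟩
    · intro t ht hl
      have := (di_one t).2 hl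
      omega
    · intro t t' ht htt'
      have h1 : 0 < θ t t' := by rw [θ_pos t t' ht.1]; exact htt'
      exact ⟨(om_of_θ t t' h1).2, by_contra fun h2 => di_step t t' h1 h2 ht.2⟩
  have hpi : ∀ s, N.reachProbFrom s α ∈ Set.Icc (0 : ℝ) 1 := N.reachProbFrom_mem_Icc α
  let σ : P.Valuation := fun
    | .par y => ν y
    | .theta s s' _ => ⟨θ s s', θ0 s s', θle s s'⟩
    | .rho s => decide ((om s).val ≠ 0)
    | .omega s => om s
    | .lam s => decide ((om s).val ≠ 0 ∧ (di s).val ≠ 0)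
    | .dist s => di s
    | .pi s => if (om s).val ≠ 0 ∧ (di s).val ≠ 0 then ⟨N.reachProbFrom s α, hpi s⟩ else 0
  have σ_par : σ.par = ν := rfl
  have σ_theta : ∀ s s', σ.theta s s' = θ s s' := by
    intro s s'
    by_cases h : s' ∈ P.succ s
    · simp only [Valuation.theta, dif_pos h, σ]
    · simp only [Valuation.theta, dif_neg h, θ_succ s s' h]
  have σ_rho : ∀ s, σ.rho s ↔ (om s).val ≠ 0 := fun s => by simp [Valuation.rho, σ]
  have σ_omega : ∀ s, σ.omega s = (om s).val := fun s => rfl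
  have σ_lam : ∀ s, σ.lam s ↔ (om s).val ≠ 0 ∧ (di s).val ≠ 0 := fun s => by
    simp [Valuation.lam, σ]
  have σ_dist : ∀ s, σ.dist s = (di s).val := fun s => rfl
  have σ_pi_zero : ∀ s, ¬ ((om s).val ≠ 0 ∧ (di s).val ≠ 0) → σ.pi s = 0 := by
    intro s h
    simp only [Valuation.pi, σ, if_neg h, Set.Icc.coe_zero]
  have σ_pi : ∀ s, (om s).val ≠ 0 → σ.pi s = N.reachProbFrom s α := by
    intro s h
    by_cases h' : (di s).val = 0
    · rw [reach_zero s h h', σ_pi_zero s fun h'' => h''.2 h']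
    · have h'' : (om s).val ≠ 0 ∧ (di s).val ≠ 0 := ⟨h, h'⟩
      simp only [Valuation.pi, σ, if_pos h'']
  clear_value σ
  have om_init : (om P.init).val = 1 := (om_one _).2 rfl
  have sum_θ : ∀ s, ((om s).val ≠ 0 → ∑ s' ∈ P.succ s, θ s s' = 1) ∧
      ((om s).val = 0 → ∑ s' ∈ P.succ s, θ s s' = 0) := by
    intro s
    have h := sum_succ s 1
    simp only [Pi.one_apply, one_mul] at h
    rw [h]
    refine ⟨fun hs => ?_, fun hs => Finset.sum_eq_zero fun s' _ => θ_zero s s' hs⟩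
    rw [← c1 s]
    exact Finset.sum_congr rfl fun s' _ => θ_pos s s' hs
  have om_down' : ∀ s, s ≠ P.init → (om s).val ≠ 0 →
      ∃ s' ∈ P.pred s \ {s}, (om s).val = (om s').val + 1 ∧ 0 < θ s' s := by
    intro s hs h
    have h1 : (om s).val ≠ 1 := fun h => hs ((om_one s).1 h)
    obtain ⟨s', hE, h2⟩ := om_down s (by omega)
    have hθ : 0 < θ s' s := by rwa [θ_pos s' s (by omega)]
    refine ⟨s', Finset.mem_sdiff.2 ⟨mem_pred_iff.2 (succ_of _ _ hθ), ?_⟩, h2, hθ⟩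
    rw [Finset.mem_singleton]
    rintro rfl
    omega
  have di_down' : ∀ s, P.label s ≠ α → (di s).val ≠ 0 →
      ∃ s' ∈ P.succ s \ {s}, (di s).val = (di s').val + 1 ∧ 0 < θ s s' := by
    intro s hs h
    have h1 : (di s).val ≠ 1 := fun h => hs ((di_one s).1 h)
    obtain ⟨s', hθ, h2⟩ := di_down s (by omega)
    refine ⟨s', Finset.mem_sdiff.2 ⟨succ_of _ _ hθ, ?_⟩, h2, hθ⟩
    rw [Finset.mem_singleton]
    rintro rfl
    omega
  refine ⟨σ, ?_, (σ_pi _ (by omega)).trans rfl⟩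
  rintro k (((hk | hk) | hk) | hk)
  · rcases hk with ((((rfl | ⟨s, rfl⟩) | ⟨s, hs, rfl⟩) | ⟨s, rfl⟩) | ⟨s, s', -, rfl⟩)
    · exact (σ_rho _).2 (by omega)
    · simp only [σ_rho, σ_theta]
      refine ⟨(sum_θ s).1, fun h h0 => ?_⟩
      rw [(sum_θ s).2 h0] at h
      exact zero_ne_one h
    · simp only [σ_rho, σ_theta, not_not]
      rw [Finset.sum_eq_zero_iff_of_nonneg fun s' _ => θ0 s' s]
      constructor
      · intro h s' _
        by_contra hne
        exact (om_of_θ s' s ((θ0 s' s).lt_of_ne' hne)).2 h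
      · intro h
        by_contra hne
        obtain ⟨s', hs', -, hθ⟩ := om_down' s hs hne
        exact hθ.ne' (h s' hs')
    · simp only [σ_rho, σ_theta, not_not]
      refine ⟨(sum_θ s).2, fun h => ?_⟩
      by_contra h0
      rw [(sum_θ s).1 h0] at h
      exact one_ne_zero h
    · simp only [σ_rho, σ_theta, σ_par]
      intro h
      rw [θ_pos s s' h]
      exact hprob s (om_W s h) s'
  · rcases hk with ((((rfl | ⟨s, hs, rfl⟩) | ⟨s, rfl⟩) | ⟨s, hs, rfl⟩) | ⟨s, hs, rfl⟩)
    · exact (σ_omega _).trans om_init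
    · beta_reduce
      rw [σ_omega, Ne, om_one]
      exact hs
    · beta_reduce
      rw [σ_omega]
      exact σ_rho s
    · simp only [σ_omega, σ_theta]
      exact fun h => om_down' s hs (by omega)
    · simp only [σ_omega, σ_theta]
      constructor
      · intro h s' _
        refine or_iff_not_imp_right.2 fun hne => ?_
        exact absurd h (om_of_θ s' s ((θ0 s' s).lt_of_ne' hne)).2
      · intro h
        by_contra hne
        obtain ⟨s', hs', h1, hθ⟩ := om_down' s hs hne
        rcases h s' hs' with h0 | h0
        · exact (om_of_θ s' s hθ).1 h0
        · exact hθ.ne' h0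
  · rcases hk with ((((⟨s, hs, rfl⟩ | ⟨s, hs, rfl⟩) | ⟨s, rfl⟩) | ⟨s, hs, rfl⟩) | ⟨s, hs, rfl⟩)
    · beta_reduce
      rw [σ_dist, di_one]
      exact hs.symm
    · beta_reduce
      rw [σ_dist, Ne, di_one]
      exact hs.symm
    · beta_reduce
      rw [σ_lam, σ_rho, σ_dist]
    · simp only [σ_dist, σ_theta]
      exact fun h => di_down' s hs.symm (by omega)
    · simp only [σ_dist, σ_theta]
      constructor
      · intro h s' _
        refine or_iff_not_imp_right.2 fun hne => ?_
        by_contra h0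
        exact di_step s s' ((θ0 s s').lt_of_ne' hne) h0 h
      · intro h
        by_contra hne
        obtain ⟨s', hs', h1, hθ⟩ := di_down' s hs.symm hne
        rcases h s' hs' with h0 | h0
        · exact hs.symm ((di_one s).1 (by omega))
        · exact hθ.ne' h0
  · rcases hk with ((⟨s, rfl⟩ | ⟨s, hs, rfl⟩) | ⟨s, hs, rfl⟩)
    · intro h
      exact σ_pi_zero s (by rwa [σ_lam] at h)
    · intro h
      rw [σ_pi s ((σ_lam s).1 h).1]
      exact N.reachProbFrom_of_label hs.symm
    · intro h
      have hom := ((σ_lam s).1 h).1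
      simp only [σ_theta]
      rw [σ_pi s hom, N.reachProbFrom_of_ne hs.symm, sum_succ]
      refine Finset.sum_congr rfl fun s' _ => ?_
      rcases (θ0 s s').eq_or_lt with h0 | h0
      · rw [← h0, mul_zero]
        have : c s s' = 0 := by rw [← θ_pos s s' hom, ← h0]
        exact mul_eq_zero_of_left this _
      · rw [σ_pi s' (om_of_θ s s' h0).2, θ_pos s s' hom, mul_comm]
        rfl

/-! ### From solutions of the constraint problem to chains -/

/-- The maximum principle that makes the linear equations for the reachability probabilities
uniquely solvable: if, wherever `u` is positive, it is a weighted average of its values and some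
state of smaller rank has positive weight, then `u` is nowhere positive. Indeed a state of minimal
rank among those where `u` is maximal contradicts this. -/
theorem nonpos_of_average {S : Type*} [Fintype S] {u : S → ℝ} {q : S → S → ℝ} {r : S → ℕ}
    (h : ∀ s, 0 < u s → (∀ s', 0 ≤ q s s') ∧ ∑ s', q s s' = 1 ∧ u s = ∑ s', q s s' * u s' ∧
      ∃ s', 0 < q s s' ∧ r s' < r s) (s : S) : u s ≤ 0 := by
  by_contra! hs
  have : Nonempty S := ⟨s⟩
  obtain ⟨k, hk⟩ := Finite.exists_max u
  have hex : ∃ n t, u t = u k ∧ r t = n := ⟨_, k, rfl, rfl⟩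
  classical
  obtain ⟨t, ht, hrt⟩ := Nat.find_spec hex
  obtain ⟨hq, hsum, hav, s', hs', hr⟩ := h t (ht ▸ hs.trans_le (hk s))
  have hdef : ∑ j, q t j * (u k - u j) = 0 := by
    simp_rw [mul_sub]
    rw [Finset.sum_sub_distrib, ← hav, ← Finset.sum_mul, hsum, ht, one_mul, sub_self]
  have hz := (Finset.sum_eq_zero_iff_of_nonneg fun j _ =>
    mul_nonneg (hq j) (sub_nonneg.2 (hk j))).1 hdef s' (Finset.mem_univ _)
  have hus' : u s' = u k := by
    rcases mul_eq_zero.1 hz with h0 | h0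
    · exact absurd h0 hs'.ne'
    · linarith
  exact Nat.find_min hex (hrt ▸ hr) ⟨s', hus', rfl⟩

/-- The transition function of a solution is a memoryless implementation of `P` on the states
with `ρ_s`; the other states, which are not reachable, get self-loops. -/
theorem exists_chain_of_solution [Finite Y] (P : PIMC A S Y) (α : Set A) (σ : P.Valuation)
    (hσ : ∀ k ∈ (P.reachCSP α).Cons, k σ) :
    ∃ N : MarkovChain A S, N.SatisfiesPIMC P ∧ N.reachProb α = σ.pi P.init := by
  classical
  have cons1 : ∀ k ∈ P.consistencyCons, k σ := fun k hk => hσ k (.inl (.inl (.inl hk)))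
  have cons2 : ∀ k ∈ P.backwardCons α, k σ := fun k hk => hσ k (.inl (.inr hk))
  have cons3 : ∀ k ∈ P.probabilityCons α, k σ := fun k hk => hσ k (.inr hk)
  have rho_init : σ.rho P.init := cons1 _ (.inl (.inl (.inl (.inl rfl))))
  have rho_sum : ∀ s, σ.rho s ↔ ∑ s' ∈ P.succ s, σ.theta s s' = 1 := fun s =>
    cons1 _ (.inl (.inl (.inl (.inr ⟨s, rfl⟩))))
  have rho_pred : ∀ s, s ≠ P.init → (¬ σ.rho s ↔ ∑ s' ∈ P.pred s \ {s}, σ.theta s' s = 0) :=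
    fun s hs => cons1 _ (.inl (.inl (.inr ⟨s, hs, rfl⟩)))
  have rho_prob : ∀ s, ∀ s' ∈ P.succ s, σ.rho s → σ.theta s s' ∈ (P.inst σ.par).prob s s' :=
    fun s s' hs' => cons1 _ (.inr ⟨s, s', hs', rfl⟩)
  have dist_one : ∀ s, α = P.label s → σ.dist s = 1 := fun s hs =>
    cons2 _ (.inl (.inl (.inl (.inl ⟨s, hs, rfl⟩))))
  have dist_ne_one : ∀ s, α ≠ P.label s → σ.dist s ≠ 1 := fun s hs =>
    cons2 _ (.inl (.inl (.inl (.inr ⟨s, hs, rfl⟩))))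
  have lam_iff : ∀ s, σ.lam s ↔ (σ.rho s ∧ σ.dist s ≠ 0) := fun s =>
    cons2 _ (.inl (.inl (.inr ⟨s, rfl⟩)))
  have dist_down : ∀ s, α ≠ P.label s → 1 < σ.dist s →
      ∃ s' ∈ P.succ s \ {s}, σ.dist s = σ.dist s' + 1 ∧ 0 < σ.theta s s' := fun s hs =>
    cons2 _ (.inl (.inr ⟨s, hs, rfl⟩))
  have dist_zero : ∀ s, α ≠ P.label s → (σ.dist s = 0 ↔
      ∀ s' ∈ P.succ s \ {s}, σ.dist s' = 0 ∨ σ.theta s s' = 0) := fun s hs =>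
    cons2 _ (.inr ⟨s, hs, rfl⟩)
  have pi_zero : ∀ s, ¬ σ.lam s → σ.pi s = 0 := fun s => cons3 _ (.inl (.inl ⟨s, rfl⟩))
  have pi_one : ∀ s, α = P.label s → σ.lam s → σ.pi s = 1 := fun s hs =>
    cons3 _ (.inl (.inr ⟨s, hs, rfl⟩))
  have pi_sum : ∀ s, α ≠ P.label s → σ.lam s →
      σ.pi s = ∑ s' ∈ P.succ s, σ.pi s' * σ.theta s s' := fun s hs => cons3 _ (.inr ⟨s, hs, rfl⟩)
  have θ0 : ∀ s s', 0 ≤ σ.theta s s' := by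
    intro s s'
    unfold Valuation.theta
    split_ifs
    exacts [unitInterval.nonneg _, le_rfl]
  have θ_succ : ∀ s s', s' ∉ P.succ s → σ.theta s s' = 0 := fun s s' h => dif_neg h
  have succ_of : ∀ s s', 0 < σ.theta s s' → s' ∈ P.succ s := fun s s' h => by
    by_contra h'
    exact h.ne' (θ_succ s s' h')
  have sum_succ : ∀ s, ∀ f : S → ℝ,
      ∑ s' ∈ P.succ s, f s' * σ.theta s s' = ∑ s', f s' * σ.theta s s' := by
    intro s f
    refine Finset.sum_subset (Finset.subset_univ _) fun s' _ h => ?_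
    rw [θ_succ s s' h, mul_zero]
  have rho_step : ∀ s s', σ.rho s → 0 < σ.theta s s' → σ.rho s' := by
    intro s s' hs h
    by_cases hss' : s = s'
    · exact hss' ▸ hs
    by_cases hi : s' = P.init
    · exact hi ▸ rho_init
    by_contra hr
    have hz := (Finset.sum_eq_zero_iff_of_nonneg fun i _ => θ0 i s').1 ((rho_pred s' hi).1 hr) s
      (Finset.mem_sdiff.2 ⟨mem_pred_iff.2 (succ_of s s' h), by simpa using hss'⟩)
    exact h.ne' hz
  let c : S → S → ℝ := fun s => if σ.rho s then σ.theta s else Pi.single s 1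
  have c_rho : ∀ s, σ.rho s → c s = σ.theta s := fun s hs => if_pos hs
  have hc : ∀ s, c s ∈ stdSimplex ℝ S := by
    intro s
    by_cases hs : σ.rho s
    · rw [c_rho s hs]
      refine ⟨θ0 s, ?_⟩
      have h := sum_succ s 1
      simp only [Pi.one_apply, one_mul] at h
      rw [← h]
      exact (rho_sum s).1 hs
    · simp only [c, if_neg hs]
      exact single_mem_stdSimplex ℝ s
  let N := MarkovChain.ofDist P.init P.label c hc
  have trans_rho : ∀ s, σ.rho s → ∀ s', N.trans s s' = σ.theta s s' := fun s hs s' =>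
    congrFun (c_rho s hs) s'
  refine ⟨N, ⟨σ.par, fun t s => t = s ∧ σ.rho s, ⟨rfl, rho_init⟩, ?_⟩, ?_⟩
  · rintro s _ ⟨rfl, hs⟩
    refine ⟨rfl, fun t' s' => if t' = s' ∧ σ.rho s' then 1 else 0, ?_, ?_, ?_, ?_⟩
    · intro t' s'
      dsimp only
      split_ifs <;> simp
    · intro t' ht'
      have ht : σ.rho t' := rho_step s t' hs (by rwa [← trans_rho s hs])
      simp [ite_and, Finset.sum_ite_eq, ht]
    · intro s'
      have h : ∑ t', N.trans s t' * (if t' = s' ∧ σ.rho s' then 1 else 0) = σ.theta s s' := by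
        rw [Finset.sum_eq_single s' (fun t' _ h => by simp [h]) (by simp), trans_rho s hs]
        rcases (θ0 s s').eq_or_lt with h | h
        · simp [← h]
        · simp [rho_step s s' hs h]
      rw [h]
      by_cases hs' : s' ∈ P.succ s
      · exact rho_prob s s' hs' hs
      · rw [θ_succ s s' hs']
        exact zero_mem_prob_of_notMem_succ _ hs'
    · intro t' s' h
      by_contra h'
      beta_reduce at h
      rw [if_neg h'] at h
      exact lt_irrefl _ h
  · have reach_zero : ∀ s, σ.rho s → ¬ σ.lam s → N.reachProbFrom s α = 0 := by
      intro s hs hl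
      have hlab : ∀ t, σ.rho t ∧ σ.dist t = 0 → N.label t ≠ α := by
        rintro t ⟨-, ht⟩ h
        have := dist_one t h.symm
        omega
      refine N.reachProbFrom_eq_zero (fun s => σ.rho s ∧ σ.dist s = 0) hlab ?_
        ⟨hs, by_contra fun h => hl ((lam_iff s).2 ⟨hs, h⟩)⟩
      intro t t' ht h
      rw [trans_rho t ht.1] at h
      refine ⟨rho_step t t' ht.1 h, ?_⟩
      by_cases htt' : t' = t
      · exact htt' ▸ ht.2
      exact (((dist_zero t (hlab t ht).symm).1 ht.2) t'
        (Finset.mem_sdiff.2 ⟨succ_of t t' h, by simpa using htt'⟩)).resolve_right h.ne'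
    -- both signs of the difference between `π` and the reachability probabilities
    have key : ∀ ε : ℝ, ∀ s, (if σ.rho s then ε * (σ.pi s - N.reachProbFrom s α) else 0) ≤ 0 := by
      intro ε
      refine nonpos_of_average (q := σ.theta) (r := σ.dist) ?_
      intro s hpos
      by_cases hs : σ.rho s
      swap
      · rw [if_neg hs] at hpos
        exact absurd hpos (lt_irrefl _)
      rw [if_pos hs] at hpos ⊢
      have hl : σ.lam s := by
        by_contra hl
        rw [pi_zero s hl, reach_zero s hs hl, sub_zero, mul_zero] at hpos
        exact lt_irrefl _ hpos
      have hα : α ≠ P.label s := by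
        intro h
        rw [pi_one s h hl, N.reachProbFrom_of_label h.symm, sub_self, mul_zero] at hpos
        exact lt_irrefl _ hpos
      have hne1 := dist_ne_one s hα
      have hne0 := ((lam_iff s).1 hl).2
      obtain ⟨s', -, hd, hθ⟩ := dist_down s hα (by omega)
      refine ⟨θ0 s, by rw [← c_rho s hs]; exact (hc s).2, ?_, s', hθ, by omega⟩
      rw [pi_sum s hα hl, sum_succ, N.reachProbFrom_of_ne hα.symm, ← Finset.sum_sub_distrib,
        Finset.mul_sum]
      refine Finset.sum_congr rfl fun t _ => ?_
      rw [trans_rho s hs]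
      rcases (θ0 s t).eq_or_lt with h | h
      · simp [← h]
      · rw [if_pos (rho_step s t hs h)]
        ring
    have h1 := key 1 P.init
    have h2 := key (-1) P.init
    rw [if_pos rho_init] at h1 h2
    change N.reachProbFrom P.init α = _
    linarith

end PIMC

/-! ### Comparison with a threshold -/

/-- The negation of a comparison operator. -/
def CompOp.neg : CompOp → CompOp
  | .le => .gt
  | .lt => .ge
  | .ge => .lt
  | .gt => .le

theorem CompOp.rel_neg (op : CompOp) (x p : ℝ) : op.neg.Rel x p ↔ ¬ op.Rel x p := by
  cases op <;> simp [CompOp.neg, CompOp.Rel]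

/-- Each comparison is inherited by all larger numbers (`ε = 1`) or by all smaller ones
(`ε = -1`). -/
theorem CompOp.exists_mono (op : CompOp) :
    ∃ ε : ℝ, ∀ x y p : ℝ, ε * x ≤ ε * y → op.Rel x p → op.Rel y p := by
  cases op
  · exact ⟨-1, fun x y p h hx => by simp only [CompOp.Rel] at *; linarith⟩
  · exact ⟨-1, fun x y p h hx => by simp only [CompOp.Rel] at *; linarith⟩
  · exact ⟨1, fun x y p h hx => by simp only [CompOp.Rel] at *; linarith⟩
  · exact ⟨1, fun x y p h hx => by simp only [CompOp.Rel] at *; linarith⟩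

theorem PIMC.satisfiable_add_iff {A : Type w} {S : Type u} {Y : Type v} [Fintype S] [Finite Y]
    (P : PIMC A S Y) (α : Set A) (p : ℝ) (op : CompOp) :
    ((P.reachCSP α).add fun σ : P.Valuation => op.Rel (σ.pi P.init) p).Satisfiable ↔
      ∃ (T : Type u) (_ : Fintype T) (M : MarkovChain A T),
        M.SatisfiesPIMC P ∧ op.Rel (M.reachProb α) p := by
  constructor
  · rintro ⟨σ, hσ⟩
    obtain ⟨N, hN, hpi⟩ := P.exists_chain_of_solution α σ fun k hk => hσ k (.inl hk)
    refine ⟨S, inferInstance, N, hN, ?_⟩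
    rw [hpi]
    exact hσ _ (.inr rfl)
  · rintro ⟨T, _, M, ⟨ν, hM⟩, hrel⟩
    obtain ⟨ε, hε⟩ := op.exists_mono
    obtain ⟨W, c, hc, hinit, hprob, hW, hle⟩ := exists_memoryless P ν M hM α ε
    obtain ⟨σ, hσ, hpi⟩ := P.exists_solution_of_ofDist α ν W c hc hinit hprob hW
    refine ⟨σ, ?_⟩
    rintro k (hk | rfl)
    · exact hσ k hk
    · change op.Rel (σ.pi P.init) p
      rw [hpi]
      exact hε _ _ _ hle hrel

theorem theorem2 {A : Type w} {S : Type u} {Y : Type v} [Fintype S] [Finite Y]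
    (P : PIMC A S Y) (α : Set A) (p : ℝ) (hp : p ∈ Set.Icc (0 : ℝ) 1) (op : CompOp) :
    (((P.reachCSP α).add fun σ : P.Valuation => op.Rel (σ.pi P.init) p).Satisfiable ↔
      ∃ (T : Type u) (_ : Fintype T) (M : MarkovChain A T),
        M.SatisfiesPIMC P ∧ op.Rel (M.reachProb α) p) ∧
    (¬ ((P.reachCSP α).add fun σ : P.Valuation => ¬ op.Rel (σ.pi P.init) p).Satisfiable ↔
      ∀ (T : Type u) (_ : Fintype T) (M : MarkovChain A T),
        M.SatisfiesPIMC P → op.Rel (M.reachProb α) p) := by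
  refine ⟨P.satisfiable_add_iff α p op, ?_⟩
  have h := P.satisfiable_add_iff α p op.neg
  simp only [CompOp.rel_neg] at h
  rw [h]
  push Not
  rfl
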